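/- Call a compact connected metric space with more than one point a continuum, and call a space homeomorphic to $[0,1]$ an arc. A finite graph is a continuum that can be written as the union of finitely many arcs, any two of which are either disjoint or intersect only in one or both of their end points. For a continuum $X$, let $C(X)$ be the set of all nonempty closed connected subsets of $X$, with the Hausdorff metric (equivalently, with the Vietoris topology), and let $$NC^{*}(X)=\{A\in C(X) : X\setminus A \text{ is connected}\}$$ with the subspace topology, where the empty set is regarded as connected, so that $X\in NC^{*}(X)$. Theorem. Let $X$ be a finite graph. Then $NC^{*}(X)$ is compact if and only if $X$ is homeomorphic to $[0,1]$ or to the circle $S^{1}$. -/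

import Mathlib

open TopologicalSpace

/-- A continuum: a compact connected metric space with more than one point. -/
structure IsContinuum (X : Type*) [MetricSpace X] : Prop where
  compact : CompactSpace X
  connected : ConnectedSpace X
  nontrivial : Nontrivial X

/-- A finite graph: a continuum that is the union of finitely many arcs (images of topological
embeddings of `[0,1]`), any two of which can meet only at points that are end points of both. -/
def IsFiniteGraph (X : Type*) [MetricSpace X] : Prop :=
  IsContinuum X ∧
    ∃ (n : ℕ) (γ : Fin n → unitInterval → X),
      (∀ i, Topology.IsEmbedding (γ i)) ∧
      (⋃ i, Set.range (γ i)) = Set.univ ∧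
      ∀ i j, i ≠ j →
        Set.range (γ i) ∩ Set.range (γ j) ⊆ {γ i 0, γ i 1} ∩ {γ j 0, γ j 1}

/-- The hyperspace `C(X)` of subcontinua: the nonempty closed connected subsets. In a compact
space, closed subsets are the same as compact subsets; `NonemptyCompacts X` carries the Hausdorff
metric, whose topology is the Vietoris topology. -/
def subcontinua (X : Type*) [MetricSpace X] : Set (NonemptyCompacts X) :=
  {A | IsConnected (A : Set X)}

/-- The hyperspace `NC*(X)`: the subcontinua whose complement is connected. The empty set counts
as connected here, so that `X` itself belongs to `NC*(X)`. -/
def nonCutSubcontinua (X : Type*) [MetricSpace X] : Set (NonemptyCompacts X) :=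
  {A | A ∈ subcontinua X ∧ IsPreconnected ((A : Set X)ᶜ)}

/-! ### Closedness in the hyperspace, and the two compact cases. -/

section Hyperspace

open Set Topology

variable {X : Type*} [MetricSpace X]

/-! The subcontinua form a closed subset of a compact hyperspace. In an arc, a subcontinuum has
connected complement exactly when it contains an end, a closed condition; in a circle the condition
always holds. So both spaces have compact `nonCutSubcontinua`.

Conversely, compactness forbids a point `v` on three arcs (`not_isCompact_nonCutSubcontinua`). Take
a component `C` of `X ∖ {v}` containing a leg `l` at `v`, and cut a small open star around `v` out
of `C`. What remains is a subcontinuum, and its complement is connected because it contains the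
whole star. Let the star's leg along `l` shrink to nothing: the limit reaches `v`, so its complement
loses `v` and the surviving pieces of the other legs fall apart.

A connected union of arcs without triple points is an arc or a circle, by induction on the number of
arcs: two arcs sharing an end either concatenate to one arc, or close up to a circle that exhausts
`X` (`arc_or_circle`). -/

/-- A disconnected compact set splits into pieces with disjoint open neighbourhoods `U`, `V`. Lying
in `U ∪ V` and meeting both is a Vietoris-open condition that rules out connectedness. -/
theorem isClosed_subcontinua : IsClosed (subcontinua X) := by
  rw [← isOpen_compl_iff, isOpen_iff_mem_nhds]
  intro A hA
  have hA' : ¬ IsPreconnected (A : Set X) := fun h => hA ⟨A.nonempty, h⟩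
  rw [isPreconnected_iff_subset_of_disjoint_closed] at hA'
  push Not at hA'
  obtain ⟨P, Q, hP, hQ, hPQ, hdis, hnP, hnQ⟩ := hA'
  obtain ⟨x, hxA, hxP⟩ := not_subset.1 hnP
  obtain ⟨y, hyA, hyQ⟩ := not_subset.1 hnQ
  have hd : Disjoint ((A : Set X) ∩ P) ((A : Set X) ∩ Q) := by
    rw [Set.disjoint_iff_inter_eq_empty, ← hdis]; ext z; simp; tauto
  obtain ⟨U, V, hU, hV, hPU, hQV, hUV⟩ := SeparatedNhds.of_isCompact_isCompact
    (A.isCompact.inter_right hP) (A.isCompact.inter_right hQ) hd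
  have hAUV : (A : Set X) ⊆ U ∪ V := fun z hz =>
    (hPQ hz).imp (fun h => hPU ⟨hz, h⟩) (fun h => hQV ⟨hz, h⟩)
  have hxV : x ∈ V := hQV ⟨hxA, (hPQ hxA).resolve_left hxP⟩
  have hyU : y ∈ U := hPU ⟨hyA, (hPQ hyA).resolve_right hyQ⟩
  filter_upwards [(NonemptyCompacts.isOpen_subsets_of_isOpen (hU.union hV)).mem_nhds hAUV,
    (NonemptyCompacts.isOpen_inter_nonempty_of_isOpen hU).mem_nhds ⟨y, hyA, hyU⟩,
    (NonemptyCompacts.isOpen_inter_nonempty_of_isOpen hV).mem_nhds ⟨x, hxA, hxV⟩]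
    with B hB hBU hBV hBc
  obtain ⟨z, -, hz⟩ := hBc.isPreconnected U V hU hV hB hBU hBV
  exact hUV.le_bot hz

theorem isClosed_setOf_mem_nonemptyCompacts (x : X) :
    IsClosed {A : NonemptyCompacts X | x ∈ (A : Set X)} := by
  have := NonemptyCompacts.isClosed_inter_nonempty_of_isClosed (isClosed_singleton (x := x))
  simpa using this

theorem isPreconnected_compl_iff_unitInterval {A : Set unitInterval} (hA : IsConnected A) :
    IsPreconnected Aᶜ ↔ 0 ∈ A ∨ 1 ∈ A := by
  have hoc := isPreconnected_iff_ordConnected.1 hA.isPreconnected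
  constructor
  · intro h
    rw [isPreconnected_iff_ordConnected] at h
    by_contra! hn
    obtain ⟨c, hc⟩ := hA.nonempty
    exact h.out hn.1 hn.2 ⟨unitInterval.nonneg', unitInterval.le_one'⟩ hc
  · intro h
    rw [isPreconnected_iff_ordConnected]
    refine ⟨fun x hx z hz y hy hyA => ?_⟩
    rcases h with h | h
    · exact hx (hoc.out h hyA ⟨unitInterval.nonneg', hy.1⟩)
    · exact hz (hoc.out hyA h ⟨hy.2, unitInterval.le_one'⟩)

theorem isCompact_nonCutSubcontinua_of_arc (e : X ≃ₜ unitInterval) :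
    IsCompact (nonCutSubcontinua X) := by
  have : CompactSpace X := e.symm.compactSpace
  have key : nonCutSubcontinua X = subcontinua X ∩
      ({A | e.symm 0 ∈ (A : Set X)} ∪ {A | e.symm 1 ∈ (A : Set X)}) := by
    ext A
    refine and_congr_right fun hA => ?_
    have hA' : IsConnected (e '' (A : Set X)) := hA.image e e.continuous.continuousOn
    rw [← e.isPreconnected_image, image_compl_eq e.bijective,
      isPreconnected_compl_iff_unitInterval hA']
    simp [e.image_eq_preimage_symm]
  rw [key]
  exact (isClosed_subcontinua.inter ((isClosed_setOf_mem_nonemptyCompacts _).union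
    (isClosed_setOf_mem_nonemptyCompacts _))).isCompact

/-- Two points outside `A` cut the circle into two open arcs. `A` lies in one of them, so the other,
with its ends, joins the points in the complement. -/
theorem isPreconnected_compl_addCircle {A : Set (AddCircle (1 : ℝ))} (hA : IsPreconnected A) :
    IsPreconnected Aᶜ := by
  have : Fact ((0 : ℝ) < 1) := ⟨one_pos⟩
  have hc : Continuous ((↑) : ℝ → AddCircle (1 : ℝ)) := AddCircle.continuous_mk' 1
  refine isPreconnected_of_forall_pair fun x hx y hy => ?_
  obtain ⟨a, -, rfl⟩ : ∃ a ∈ Ico (0 : ℝ) (0 + 1), (a : AddCircle (1 : ℝ)) = x :=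
    ⟨_, (AddCircle.equivIco 1 0 x).2, (AddCircle.equivIco 1 0).symm_apply_apply x⟩
  obtain ⟨b, hb, rfl⟩ : ∃ b ∈ Ico a (a + 1), (b : AddCircle (1 : ℝ)) = y :=
    ⟨_, (AddCircle.equivIco 1 a y).2, (AddCircle.equivIco 1 a).symm_apply_apply y⟩
  have haa : ((a + 1 : ℝ) : AddCircle (1 : ℝ)) = a := AddCircle.coe_add_period 1 a
  let O₁ : Set (AddCircle (1 : ℝ)) := (↑) '' Ioo a b
  let O₂ : Set (AddCircle (1 : ℝ)) := (↑) '' Ioo b (a + 1)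
  have ho : IsOpenMap ((↑) : ℝ → AddCircle (1 : ℝ)) := QuotientAddGroup.isOpenMap_coe
  have hcov : A ⊆ O₁ ∪ O₂ := by
    intro z hz
    obtain ⟨c, hc, rfl⟩ : ∃ c ∈ Ico a (a + 1), (c : AddCircle (1 : ℝ)) = z :=
      ⟨_, (AddCircle.equivIco 1 a z).2, (AddCircle.equivIco 1 a).symm_apply_apply z⟩
    have h1 : a ≠ c := by rintro rfl; exact hx hz
    have h2 : b ≠ c := by rintro rfl; exact hy hz
    rcases lt_or_gt_of_ne h2 with h | h
    · exact Or.inr ⟨c, ⟨h, hc.2⟩, rfl⟩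
    · exact Or.inl ⟨c, ⟨lt_of_le_of_ne hc.1 h1, h⟩, rfl⟩
  have hdis : A ∩ (O₁ ∩ O₂) = ∅ := by
    rw [eq_empty_iff_forall_notMem]
    rintro _ ⟨-, ⟨s, hs, rfl⟩, t, ht, hts⟩
    have := (AddCircle.coe_eq_coe_iff_of_mem_Ico (p := (1 : ℝ)) (a := a)
      ⟨hb.1.trans ht.1.le, ht.2⟩ ⟨hs.1.le, hs.2.trans hb.2⟩).1 hts
    exact absurd hs.2 (not_lt.2 (this ▸ ht.1.le))
  rcases isPreconnected_iff_subset_of_disjoint.1 hA O₁ O₂ (ho _ isOpen_Ioo) (ho _ isOpen_Ioo)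
    hcov hdis with h | h
  · refine ⟨(↑) '' Icc b (a + 1), ?_, ⟨a + 1, ⟨hb.2.le, le_rfl⟩, haa⟩,
      ⟨b, ⟨le_rfl, hb.2.le⟩, rfl⟩, isPreconnected_Icc.image _ hc.continuousOn⟩
    rintro _ ⟨s, hs, rfl⟩ hsA
    rcases hs.2.eq_or_lt with rfl | h1
    · exact hx (haa ▸ hsA)
    rcases hs.1.eq_or_lt with rfl | h2
    · exact hy hsA
    · exact (eq_empty_iff_forall_notMem.1 hdis _) ⟨hsA, h hsA, s, ⟨h2, h1⟩, rfl⟩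
  · refine ⟨(↑) '' Icc a b, ?_, ⟨a, ⟨le_rfl, hb.1⟩, rfl⟩,
      ⟨b, ⟨hb.1, le_rfl⟩, rfl⟩, isPreconnected_Icc.image _ hc.continuousOn⟩
    rintro _ ⟨s, hs, rfl⟩ hsA
    rcases hs.1.eq_or_lt with rfl | h1
    · exact hx hsA
    rcases hs.2.eq_or_lt with rfl | h2
    · exact hy hsA
    · exact (eq_empty_iff_forall_notMem.1 hdis _) ⟨hsA, ⟨s, ⟨h1, h2⟩, rfl⟩, h hsA⟩

theorem isCompact_nonCutSubcontinua_of_circle (e : X ≃ₜ Circle) :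
    IsCompact (nonCutSubcontinua X) := by
  have : CompactSpace X := e.symm.compactSpace
  let f : X ≃ₜ AddCircle (1 : ℝ) := e.trans (AddCircle.homeomorphCircle one_ne_zero).symm
  have key : nonCutSubcontinua X = subcontinua X := by
    ext A
    refine and_iff_left_of_imp fun hA => ?_
    have hA' : IsConnected (f '' (A : Set X)) := hA.image f f.continuous.continuousOn
    rw [← f.isPreconnected_image, image_compl_eq f.bijective]
    exact isPreconnected_compl_addCircle hA'.isPreconnected
  rw [key]
  exact isClosed_subcontinua.isCompact

end Hyperspace

/-! ### A triple point destroys compactness. -/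

section TriplePoint

open Set Topology unitInterval

/-- A family of arcs covering `X`, any two of which meet only at points that are end points of
both. -/
structure IsArcDecomposition {X ι : Type*} [TopologicalSpace X] (γ : ι → I → X) : Prop where
  continuous : ∀ i, Continuous (γ i)
  injective : ∀ i, Function.Injective (γ i)
  cover : ∀ x, ∃ i s, γ i s = x
  inter : ∀ {i j s t}, i ≠ j → γ i s = γ j t → (s = 0 ∨ s = 1) ∧ (t = 0 ∨ t = 1)

/-- `C` is attached to the rest only at `v`: in a closed splitting of `Cᶜ`, adding `C` to the part
containing `v` would split `X`. -/
theorem isPreconnected_compl_of_isOpen_of_isClosed_insert {X : Type*} [TopologicalSpace X]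
    [PreconnectedSpace X] {C : Set X} {v : X} (hne : C.Nonempty)
    (ho : IsOpen C) (hcl : IsClosed (insert v C)) : IsPreconnected Cᶜ := by
  by_cases hv : v ∈ C
  · rw [insert_eq_of_mem hv] at hcl
    rw [IsClopen.eq_univ ⟨hcl, ho⟩ hne, compl_univ]
    exact isPreconnected_empty
  rw [isPreconnected_closed_iff]
  have main : ∀ P Q : Set X, IsClosed P → IsClosed Q → Cᶜ ⊆ P ∪ Q → (Cᶜ ∩ Q).Nonempty → v ∈ P →
      (Cᶜ ∩ (P ∩ Q)).Nonempty := by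
    intro P Q hP hQ hPQ hQn hvP
    have h := isPreconnected_closed_iff.1 (isPreconnected_univ (α := X)) (insert v C ∪ P)
      (Cᶜ ∩ Q) (hcl.union hP) (ho.isClosed_compl.inter hQ) (fun x _ => by
        by_cases hx : x ∈ C
        · exact Or.inl (Or.inl (Or.inr hx))
        · exact (hPQ hx).imp Or.inr fun h => ⟨hx, h⟩)
      ⟨v, trivial, Or.inr hvP⟩ (by simpa using hQn)
    obtain ⟨x, -, hx, hxC, hxQ⟩ := h
    rcases hx with (rfl | hx) | hx
    · exact ⟨x, hxC, hvP, hxQ⟩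
    · exact absurd hx hxC
    · exact ⟨x, hxC, hx, hxQ⟩
  intro P Q hP hQ hPQ hPn hQn
  rcases hPQ hv with h | h
  · exact main P Q hP hQ hPQ hQn h
  · rw [inter_comm P Q]
    exact main Q P hQ hP (by rwa [union_comm]) hPn h

namespace IsArcDecomposition

variable {X ι : Type*} [MetricSpace X] {γ : ι → I → X} {v : X}

theorem eq_of_mem_Ioo (D : IsArcDecomposition γ) {i j : ι} {s t : I} (h0 : 0 < s) (h1 : s < 1)
    (h : γ j t = γ i s) : j = i ∧ t = s := by
  by_cases hij : j = i
  · subst hij; exact ⟨rfl, D.injective _ h⟩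
  · rcases (D.inter hij h).2 with rfl | rfl
    · exact absurd h0 (lt_irrefl _)
    · exact absurd h1 (lt_irrefl _)

theorem isClosed_image (D : IsArcDecomposition γ) (i : ι) {S : Set I} (hS : IsClosed S) :
    IsClosed (γ i '' S) :=
  (hS.isCompact.image (D.continuous i)).isClosed

theorem isOpen_image_Ioo [Finite ι] (D : IsArcDecomposition γ) (i : ι) (r : I) :
    IsOpen (γ i '' Ioo 0 r) := by
  have : (γ i '' Ioo 0 r)ᶜ = γ i '' (Ioo 0 r)ᶜ ∪ ⋃ j ∈ {j | j ≠ i}, range (γ j) := by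
    ext x
    simp only [mem_compl_iff, mem_union, mem_iUnion, mem_range, mem_ofPred_eq, exists_prop]
    constructor
    · intro hx
      obtain ⟨j, s, rfl⟩ := D.cover x
      by_cases hij : j = i
      · subst hij
        exact Or.inl ⟨s, fun hs => hx ⟨s, hs, rfl⟩, rfl⟩
      · exact Or.inr ⟨j, hij, s, rfl⟩
    · rintro (⟨s, hs, rfl⟩ | ⟨j, hij, t, rfl⟩) ⟨u, hu, h⟩
      · exact hs (D.injective i h ▸ hu)
      · exact hij (D.eq_of_mem_Ioo hu.1 (hu.2.trans_le le_one') h.symm).1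
  rw [← isClosed_compl_iff, this]
  refine (D.isClosed_image i isOpen_Ioo.isClosed_compl).union ?_
  refine (toFinite _).isClosed_biUnion fun j _ => ?_
  rw [← image_univ]
  exact D.isClosed_image j isClosed_univ

/-- `C` is a union of arcs of the decomposition, with `v` removed. -/
def Saturated (γ : ι → I → X) (v : X) (C : Set X) : Prop :=
  v ∉ C ∧ ∀ i, (∀ s, γ i s ≠ v → γ i s ∈ C) ∨ ∀ s, γ i s ∉ C

theorem Saturated.isClosed_insert [Finite ι] (D : IsArcDecomposition γ) {C : Set X}
    (hC : Saturated γ v C) : IsClosed (insert v C) := by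
  have : insert v C = {v} ∪ ⋃ i ∈ {i | ∀ s, γ i s ≠ v → γ i s ∈ C}, range (γ i) := by
    ext x
    simp only [mem_insert_iff, mem_union, mem_singleton_iff, mem_iUnion, mem_range, mem_ofPred_eq,
      exists_prop]
    constructor
    · rintro (rfl | hx)
      · exact Or.inl rfl
      · obtain ⟨i, s, rfl⟩ := D.cover x
        exact Or.inr ⟨i, (hC.2 i).resolve_right fun h => h s hx, s, rfl⟩
    · rintro (rfl | ⟨i, hi, s, rfl⟩)
      · exact Or.inl rfl
      · by_cases h : γ i s = v
        · exact Or.inl h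
        · exact Or.inr (hi s h)
  rw [this]
  refine isClosed_singleton.union ((toFinite _).isClosed_biUnion fun j _ => ?_)
  rw [← image_univ]
  exact D.isClosed_image j isClosed_univ

/-- The points other than `v` outside `C` again form a saturated set, so `Saturated.isClosed_insert`
applies to them. -/
theorem Saturated.isOpen [Finite ι] (D : IsArcDecomposition γ) {C : Set X}
    (hC : Saturated γ v C) : IsOpen C := by
  have h : Saturated γ v (insert v C)ᶜ := by
    refine ⟨by simp, fun i => ?_⟩
    rcases hC.2 i with h | h
    · right
      intro s hs
      by_cases h' : γ i s = v
      · exact hs (Or.inl h')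
      · exact hs (Or.inr (h s h'))
    · left
      rintro s hs (h' | h')
      · exact hs h'
      · exact h s h'
  have := h.isClosed_insert D
  have h2 : insert v (insert v C)ᶜ = Cᶜ := by
    ext x
    by_cases hx : x = v
    · subst hx; simp [hC.1]
    · simp [hx]
  rwa [h2, isClosed_compl_iff] at this

/-- An arc can pass through `v` only at parameter `0`, so it stays connected when `v` is removed and
cannot meet two components. -/
theorem saturated_connectedComponentIn
    (hv : ∀ i s, γ i s = v → s = 0) (D : IsArcDecomposition γ) (x : X) :
    Saturated γ v (connectedComponentIn {v}ᶜ x) := by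
  refine ⟨fun h => connectedComponentIn_subset _ _ h rfl, fun i => ?_⟩
  by_contra! h
  obtain ⟨⟨s, hsv, hs⟩, t, ht⟩ := h
  have hpre : IsPreconnected (γ i '' {s | γ i s ≠ v}) := by
    refine IsPreconnected.image ?_ _ (D.continuous i).continuousOn
    rw [isPreconnected_iff_ordConnected]
    refine ⟨fun a ha b _ c hc hcv => ha ?_⟩
    have h0 := hv i c hcv
    rw [h0] at hc hcv
    rwa [le_antisymm hc.1 nonneg']
  have htv : γ i t ≠ v := fun h => connectedComponentIn_subset _ _ ht h
  have hsub : γ i '' {s | γ i s ≠ v} ⊆ {v}ᶜ := by rintro _ ⟨u, hu, rfl⟩; exact hu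
  rw [connectedComponentIn_eq ht] at hs
  exact hs (hpre.subset_connectedComponentIn ⟨t, htv, rfl⟩ hsub ⟨s, hsv, rfl⟩)

/-- The complement of the star at `v` with legs of parameter length `r`. -/
def truncation (γ : ι → I → X) (v : X) (r : ι → I) : Set X :=
  ⋃ i, γ i '' {s | γ i 0 = v → r i ≤ s}

theorem isClosed_truncation [Finite ι] (D : IsArcDecomposition γ) (r : ι → I) :
    IsClosed (truncation γ v r) := by
  refine isClosed_iUnion_of_finite fun i => D.isClosed_image i ?_
  by_cases h : γ i 0 = v
  · simp only [h, true_imp_iff]; exact isClosed_Ici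
  · simp [h]

theorem mem_truncation {X ι : Type*} {γ : ι → I → X} {v : X} {r : ι → I} {x : X} :
    x ∈ truncation γ v r ↔ ∃ i s, (γ i 0 = v → r i ≤ s) ∧ γ i s = x := by
  simp [truncation]

theorem notMem_truncation_iff (D : IsArcDecomposition γ) (hv : ∀ i s, γ i s = v → s = 0)
    {r : ι → I} (hr : ∀ i, 0 < r i) {x : X} :
    x ∉ truncation γ v r ↔ ∃ i s, γ i 0 = v ∧ s < r i ∧ γ i s = x := by
  rw [mem_truncation]
  constructor
  · intro h
    obtain ⟨i, s, rfl⟩ := D.cover x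
    by_contra! h'
    exact h ⟨i, s, fun h0 => not_lt.1 fun hs => h' i s h0 hs rfl, rfl⟩
  · rintro ⟨i, s, h0, hs, rfl⟩ ⟨j, t, ht, h⟩
    by_cases hij : j = i
    · subst hij
      rw [D.injective _ h] at ht
      exact not_lt.2 (ht h0) hs
    · rcases (D.inter hij h).2 with rfl | rfl
      · rw [h0] at h
        rw [hv j t h] at ht h
        exact not_lt.2 (ht h) (hr j)
      · exact not_lt.2 le_one' hs

theorem self_notMem_truncation {X ι : Type*} {γ : ι → I → X} {v : X} (hv : ∀ i s, γ i s = v → s = 0)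
    {r : ι → I} (hr : ∀ i, 0 < r i) : v ∉ truncation γ v r := by
  rw [mem_truncation]
  rintro ⟨j, t, ht, h⟩
  rw [hv j t h] at ht h
  exact not_lt.2 (ht h) (hr j)

theorem isPreconnected_compl_truncation (D : IsArcDecomposition γ)
    (hv : ∀ i s, γ i s = v → s = 0) {r : ι → I} (hr : ∀ i, 0 < r i) :
    IsPreconnected (truncation γ v r)ᶜ := by
  have : (truncation γ v r)ᶜ = ⋃ i : {i // γ i 0 = v}, γ i '' Iio (r i) := by
    ext x
    rw [mem_compl_iff, D.notMem_truncation_iff hv hr]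
    simp
  rw [this]
  refine isPreconnected_iUnion ⟨v, mem_iInter.2 fun i => ⟨0, hr i, i.2⟩⟩ fun i =>
    IsPreconnected.image ?_ _ (D.continuous i).continuousOn
  exact isPreconnected_Iio

/-- Trimming removes no junction of arcs other than `v`, so a splitting of the trimmed set would
extend to whole arcs and split `C`. -/
theorem isPreconnected_inter_truncation [Finite ι] (D : IsArcDecomposition γ)
    (hv : ∀ i s, γ i s = v → s = 0) {r : ι → I} {C : Set X} (hC : Saturated γ v C)
    (hCp : IsPreconnected C) (hr : ∀ i, 0 < r i) :
    IsPreconnected (C ∩ truncation γ v r) := by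
  let E : ι → Set X := fun i => γ i '' {s | γ i 0 = v → r i ≤ s}
  let J : Set ι := {i | ∀ s, γ i s ≠ v → γ i s ∈ C}
  have hJ : ∀ {i s}, γ i s ∈ C → i ∈ J := fun {i s} h => (hC.2 i).resolve_right fun h' => h' s h
  have hE : ∀ i ∈ J, E i ⊆ C ∩ truncation γ v r := by
    rintro i hi _ ⟨s, hs, rfl⟩
    refine ⟨hi s fun h => ?_, mem_truncation.2 ⟨i, s, hs, rfl⟩⟩
    have h0 := hv i s h
    subst h0
    exact not_lt.2 (hs h) (hr i)
  have hE1 : ∀ i, γ i 1 ∈ E i := fun i => ⟨1, fun _ => le_one', rfl⟩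
  have hEp : ∀ i, IsPreconnected (E i) := by
    intro i
    refine IsPreconnected.image ?_ _ (D.continuous i).continuousOn
    by_cases h : γ i 0 = v
    · simp only [h, true_imp_iff]; exact isPreconnected_Ici
    · simpa [h] using isPreconnected_univ
  rw [isPreconnected_closed_iff]
  intro P Q hP hQ hPQ hPn hQn
  by_contra hne
  have hsub : ∀ i ∈ J, E i ⊆ P ∨ E i ⊆ Q := fun i hi =>
    isPreconnected_iff_subset_of_disjoint_closed.1 (hEp i) P Q hP hQ ((hE i hi).trans hPQ)
      (eq_empty_iff_forall_notMem.2 fun x hx => hne ⟨x, hE i hi hx.1, hx.2⟩)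
  have hcl : ∀ R : Set X, IsClosed (⋃ i ∈ {i | i ∈ J ∧ E i ⊆ R}, range (γ i)) := fun R =>
    (toFinite _).isClosed_biUnion fun j _ => by
      rw [← image_univ]
      exact D.isClosed_image j isClosed_univ
  have hmem : ∀ {R : Set X} {x}, x ∈ (⋃ i ∈ {i | i ∈ J ∧ E i ⊆ R}, range (γ i)) ↔
      ∃ i ∈ J, E i ⊆ R ∧ ∃ s, γ i s = x := by
    intro R x; simp [and_assoc]
  have hpt : ∀ {x}, x ∈ C ∩ truncation γ v r → ∃ i ∈ J, x ∈ E i := by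
    rintro x ⟨hxC, hxT⟩
    obtain ⟨i, s, hs, rfl⟩ := mem_truncation.1 hxT
    exact ⟨i, hJ hxC, s, hs, rfl⟩
  have hEC : ∀ {x i}, x ∈ E i → ∃ s, γ i s = x := fun ⟨s, _, h⟩ => ⟨s, h⟩
  -- Sort the untrimmed arcs by the side of their trimmed parts. The two closed unions cover `C`, so
  -- they meet at some `y ∈ C`; as `y ≠ v`, a junction at `y` survives the trimming.
  obtain ⟨y, hyC, hyP, hyQ⟩ := isPreconnected_closed_iff.1 hCp _ _ (hcl P) (hcl Q)
    (by
      intro x hx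
      obtain ⟨i, s, rfl⟩ := D.cover x
      exact (hsub i (hJ hx)).imp (fun h => hmem.2 ⟨i, hJ hx, h, s, rfl⟩)
        (fun h => hmem.2 ⟨i, hJ hx, h, s, rfl⟩))
    (by
      obtain ⟨x, hx, hxP⟩ := hPn
      obtain ⟨i, hi, hxi⟩ := hpt hx
      refine ⟨x, hx.1, hmem.2 ⟨i, hi, (hsub i hi).resolve_right fun h => ?_, hEC hxi⟩⟩
      exact hne ⟨x, hx, hxP, h hxi⟩)
    (by
      obtain ⟨x, hx, hxQ⟩ := hQn
      obtain ⟨i, hi, hxi⟩ := hpt hx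
      refine ⟨x, hx.1, hmem.2 ⟨i, hi, (hsub i hi).resolve_left fun h => ?_, hEC hxi⟩⟩
      exact hne ⟨x, hx, h hxi, hxQ⟩)
  obtain ⟨i, hi, hiP, s, rfl⟩ := hmem.1 hyP
  obtain ⟨j, hj, hjQ, t, hts⟩ := hmem.1 hyQ
  by_cases hij : j = i
  · subst hij
    exact hne ⟨_, hE j hi (hE1 j), hiP (hE1 j), hjQ (hE1 j)⟩
  · have hyv : γ i s ≠ v := fun h => hC.1 (h ▸ hyC)
    obtain ⟨ht, hs⟩ := D.inter hij hts
    have hsE : γ i s ∈ E i := by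
      refine ⟨s, fun h0 => ?_, rfl⟩
      rcases hs with rfl | rfl
      · exact absurd h0 hyv
      · exact le_one'
    have htE : γ i s ∈ E j := by
      refine ⟨t, fun h0 => ?_, hts⟩
      rcases ht with rfl | rfl
      · exact absurd (hts.symm.trans h0) hyv
      · exact le_one'
    exact hne ⟨_, hE i hi hsE, hiP hsE, hjQ htE⟩

/-- The limit argument: the set in the conclusion is the limit, as `t → 0`, of the sets with
trimming length `t` on leg `l` and fixed `c` on the others, all of which are in `nonCutSubcontinua
X`. -/
theorem isPreconnected_compl_of_isCompact_nonCutSubcontinua [Finite ι] [CompactSpace X] [ConnectedSpace X]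
    [DecidableEq ι] (D : IsArcDecomposition γ) (hv : ∀ i s, γ i s = v → s = 0) {C : Set X}
    (hC : Saturated γ v C) (hCp : IsPreconnected C) {l : ι} (hl : γ l 0 = v) (hlC : γ l 1 ∈ C)
    {c : I} (hc : 0 < c) (hcpt : IsCompact (nonCutSubcontinua X)) :
    IsPreconnected (insert v C ∩ truncation γ v (Function.update (fun _ => c) l 0))ᶜ := by
  let r : I → ι → I := fun t => Function.update (fun _ => c) l t
  have hrl : ∀ t, r t l = t := fun t => Function.update_self _ _ _
  have hrj : ∀ t j, j ≠ l → r t j = c := fun t j h => Function.update_of_ne h _ _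
  have hr : ∀ t, 0 < t → ∀ i, 0 < r t i := by
    intro t ht i
    by_cases h : i = l
    · subst h; rwa [hrl]
    · rwa [hrj t i h]
  have hcomp : ∀ t, IsCompact (insert v C ∩ truncation γ v (r t)) := fun t =>
    ((hC.isClosed_insert D).inter (D.isClosed_truncation _)).isCompact
  have hmem1 : ∀ t, γ l 1 ∈ truncation γ v (r t) := fun t =>
    mem_truncation.2 ⟨l, 1, fun _ => le_one', rfl⟩
  let A : I → NonemptyCompacts X := fun t =>
    ⟨⟨insert v C ∩ truncation γ v (r t), hcomp t⟩, ⟨γ l 1, Or.inr hlC, hmem1 t⟩⟩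
  have hA : ∀ t, (A t : Set X) = insert v C ∩ truncation γ v (r t) := fun _ => rfl
  have hA' : ∀ t, 0 < t → (A t : Set X) = C ∩ truncation γ v (r t) := by
    intro t ht
    rw [hA]
    ext x
    refine ⟨?_, fun h => ⟨Or.inr h.1, h.2⟩⟩
    rintro ⟨rfl | h, h'⟩
    · exact absurd h' (self_notMem_truncation hv (hr t ht))
    · exact ⟨h, h'⟩
  have hAmem : ∀ t, 0 < t → A t ∈ nonCutSubcontinua X := by
    intro t ht
    refine ⟨⟨(A t).nonempty, ?_⟩, ?_⟩
    · rw [hA' t ht]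
      exact D.isPreconnected_inter_truncation hv hC hCp (hr t ht)
    -- The complement is `Cᶜ` together with the open star, two connected sets sharing `v`.
    · rw [hA' t ht, compl_inter]
      exact (isPreconnected_compl_of_isOpen_of_isClosed_insert ⟨_, hlC⟩ (hC.isOpen D)
        (hC.isClosed_insert D)).union v hC.1 (self_notMem_truncation hv (hr t ht))
        (D.isPreconnected_compl_truncation hv (hr t ht))
  have hA0 : A 0 ∈ closure (nonCutSubcontinua X) := by
    rw [Metric.mem_closure_iff]
    intro ε hε
    have hcont : ∀ᶠ s in 𝓝 (0 : I), dist (γ l s) (γ l 0) < ε / 4 :=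
      Metric.tendsto_nhds.1 (D.continuous l).continuousAt (ε / 4) (by positivity)
    obtain ⟨u, hu, hus⟩ := exists_Ico_subset_of_mem_nhds hcont ⟨1, by simp⟩
    obtain ⟨t, ht0, htu⟩ := exists_between hu
    refine ⟨A t, hAmem t ht0, ?_⟩
    have key : dist (A 0) (A t) ≤ ε / 2 := by
      rw [Metric.NonemptyCompacts.dist_eq]
      refine Metric.hausdorffDist_le_of_mem_dist (by positivity) ?_ ?_
      · intro x hx
        rw [hA] at hx
        obtain ⟨hxC, hxT⟩ := hx
        obtain ⟨i, s, his, rfl⟩ := mem_truncation.1 hxT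
        by_cases hil : i = l
        · subst hil
          by_cases hst : t ≤ s
          · refine ⟨γ i s, ?_, by rw [dist_self]; positivity⟩
            rw [hA]
            exact ⟨hxC, mem_truncation.2 ⟨i, s, fun _ => by rwa [hrl], rfl⟩⟩
          -- Points of leg `l` below `t` are matched with `γ l t`; both lie within `ε / 4` of `v`.
          · refine ⟨γ i t, ?_, ?_⟩
            · rw [hA]
              refine ⟨Or.inr (((hC.2 i).resolve_right fun h => h 1 hlC) t fun h =>
                ht0.ne' (hv i t h)), mem_truncation.2 ⟨i, t, fun _ => by rw [hrl], rfl⟩⟩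
            · have h1 : dist (γ i s) (γ i 0) < ε / 4 :=
                hus ⟨nonneg', (not_le.1 hst).trans htu⟩
              have h2 : dist (γ i t) (γ i 0) < ε / 4 := hus ⟨nonneg', htu⟩
              have := dist_triangle_right (γ i s) (γ i t) (γ i 0)
              linarith
        · refine ⟨γ i s, ?_, by rw [dist_self]; positivity⟩
          rw [hA]
          refine ⟨hxC, mem_truncation.2 ⟨i, s, fun h => ?_, rfl⟩⟩
          rw [hrj t i hil, ← hrj 0 i hil]
          exact his h
      · intro x hx
        refine ⟨x, ?_, by rw [dist_self]; positivity⟩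
        rw [hA] at hx ⊢
        obtain ⟨i, s, his, rfl⟩ := mem_truncation.1 hx.2
        refine ⟨hx.1, mem_truncation.2 ⟨i, s, fun h => le_trans ?_ (his h), rfl⟩⟩
        by_cases hil : i = l
        · subst hil; rw [hrl]; exact nonneg'
        · rw [hrj _ _ hil, hrj _ _ hil]
    linarith
  rw [hcpt.isClosed.closure_eq] at hA0
  exact hA0.2

theorem not_isCompact_nonCutSubcontinua_of_oriented [Finite ι] [CompactSpace X] [ConnectedSpace X]
    (D : IsArcDecomposition γ) (hv : ∀ i s, γ i s = v → s = 0) {i j k : ι} (hij : i ≠ j)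
    (hik : i ≠ k) (hjk : j ≠ k) (hi : γ i 0 = v) (hj : γ j 0 = v) (hk : γ k 0 = v) :
    ¬ IsCompact (nonCutSubcontinua X) := by
  classical
  intro hcpt
  let K : ι → Set X := fun i => connectedComponentIn {v}ᶜ (γ i 1)
  have hne : ∀ i s, 0 < s → γ i s ≠ v := fun i s hs h => hs.ne' (hv i s h)
  have hK1 : ∀ i, γ i 1 ∈ K i := fun i => mem_connectedComponentIn (hne i 1 one_pos)
  have hKs : ∀ i, Saturated γ v (K i) := fun i => saturated_connectedComponentIn hv D _
  have hKp : ∀ i, IsPreconnected (K i) := fun i => isPreconnected_connectedComponentIn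
  have hKm : ∀ {i j s}, 0 < s → (γ i s ∈ K j ↔ K i = K j) := by
    intro i j s hs
    have h1 : γ i 1 ∈ K j ↔ K i = K j :=
      ⟨fun h => (connectedComponentIn_eq h).symm, fun h => h ▸ hK1 i⟩
    rw [← h1]
    rcases (hKs j).2 i with h | h
    · exact ⟨fun _ => h 1 (hne i 1 one_pos), fun _ => h s (hne i s hs)⟩
    · exact ⟨fun h' => absurd h' (h s), fun h' => absurd h' (h 1)⟩
  obtain ⟨c, hc0, hc1⟩ := exists_between (zero_lt_one (α := I))
  obtain ⟨d, hd0, hdc⟩ := exists_between hc0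
  let T : ι → Set X := fun l => truncation γ v (Function.update (fun _ => c) l 0)
  have hvT : ∀ l, γ l 0 = v → v ∈ T l := fun l hl =>
    mem_truncation.2 ⟨l, 0, fun _ => by rw [Function.update_self], hl⟩
  have hdT : ∀ l m, m ≠ l → γ m 0 = v → γ m d ∉ T l := by
    intro l m hml hm h
    obtain ⟨n, t, ht, h⟩ := mem_truncation.1 h
    obtain ⟨rfl, rfl⟩ := D.eq_of_mem_Ioo hd0 (hdc.trans hc1) h
    have := ht hm
    rw [Function.update_of_ne hml] at this
    exact not_lt.2 this hdc
  -- If `l` and `m` shared a component, the open segment of leg `m` up to `c` would be clopen in the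
  -- limit's complement, which also contains `γ n d`.
  have same : ∀ l m n, l ≠ m → l ≠ n → m ≠ n → γ l 0 = v → γ m 0 = v → γ n 0 = v →
      K l ≠ K m := by
    intro l m n hlm hln hmn hl hm hn hKlm
    have h := D.isPreconnected_compl_of_isCompact_nonCutSubcontinua hv (hKs l) (hKp l) hl (hK1 l)
      hc0 hcpt
    have hcov : (insert v (K l) ∩ T l)ᶜ ⊆ γ m '' Ioo 0 c ∪ (γ m '' Icc 0 c)ᶜ := by
      intro x hx
      by_cases hxm : x ∈ γ m '' Icc 0 c
      · obtain ⟨s, hs, rfl⟩ := hxm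
        rcases hs.1.eq_or_lt with rfl | h0
        · rw [hm] at hx
          exact absurd ⟨Or.inl rfl, hvT l hl⟩ hx
        rcases hs.2.eq_or_lt with rfl | h1
        · refine absurd ⟨Or.inr ((hKm h0).2 hKlm.symm), mem_truncation.2 ⟨m, s, fun _ => ?_, rfl⟩⟩ hx
          rw [Function.update_of_ne hlm.symm]
        · exact Or.inl ⟨s, ⟨h0, h1⟩, rfl⟩
      · exact Or.inr hxm
    have hnm : γ n d ∉ γ m '' Icc 0 c := by
      rintro ⟨t, -, h⟩
      exact hmn (D.eq_of_mem_Ioo hd0 (hdc.trans hc1) h).1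
    obtain ⟨x, -, hx, hx'⟩ := h _ _ (D.isOpen_image_Ioo m c)
      (D.isClosed_image m isClosed_Icc).isOpen_compl hcov
      ⟨γ m d, fun h => hdT l m hlm.symm hm h.2, d, ⟨hd0, hdc⟩, rfl⟩
      ⟨γ n d, fun h => hdT l n hln.symm hn h.2, hnm⟩
    exact hx' (image_mono Ioo_subset_Icc_self hx)
  have h := D.isPreconnected_compl_of_isCompact_nonCutSubcontinua hv (hKs i) (hKp i) hi (hK1 i)
    hc0 hcpt
  -- With the three components distinct, `K j` is clopen in the limit's complement and misses leg
  -- `k`.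
  have hcov : (insert v (K i) ∩ T i)ᶜ ⊆ K j ∪ (insert v (K j))ᶜ := by
    intro x hx
    by_cases hxj : x ∈ K j
    · exact Or.inl hxj
    · refine Or.inr ?_
      rintro (rfl | h)
      · exact hx ⟨Or.inl rfl, hvT i hi⟩
      · exact hxj h
  have hkj : γ k d ∉ insert v (K j) := by
    rintro (h | h)
    · exact hne k d hd0 h
    · exact same j k i hjk hij.symm hik.symm hj hk hi ((hKm hd0).1 h).symm
  obtain ⟨x, -, hx, hx'⟩ := h _ _ ((hKs j).isOpen D)
    ((hKs j).isClosed_insert D).isOpen_compl hcov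
    ⟨γ j d, fun h => hdT i j hij.symm hj h.2, (hKm hd0).2 rfl⟩
    ⟨γ k d, fun h => hdT i k hik.symm hk h.2, hkj⟩
  exact hx' (Or.inr hx)

end IsArcDecomposition

end TriplePoint

/-! ### Arcs without triple points form an arc or a circle. -/

section Classification

open Set Topology unitInterval

theorem Path.trans_apply_eq_trans_apply {X : Type*} [TopologicalSpace X] {a b c : X}
    {p : Path a b} {q : Path b c} (hp : Function.Injective p) (hq : Function.Injective q)
    (h : ∀ s t, p s = q t → (s = 1 ∧ t = 0) ∨ (s = 0 ∧ t = 1)) {s t : I}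
    (hst : p.trans q s = p.trans q t) : s = t ∨ (s = 0 ∧ t = 1) ∨ (s = 1 ∧ t = 0) := by
  simp only [Path.trans_apply] at hst
  split_ifs at hst with hs ht ht
  · left
    have := congrArg Subtype.val (hp hst)
    ext; simpa using this
  · rcases h _ _ hst with ⟨h1, h2⟩ | ⟨h1, h2⟩ <;>
      (have h1 := congrArg Subtype.val h1; have h2 := congrArg Subtype.val h2
       simp at h1 h2)
    · exact absurd (by linarith : (t : ℝ) ≤ 1 / 2) ht
    · exact Or.inr (Or.inl ⟨h1, Subtype.ext (show (t : ℝ) = 1 by linarith)⟩)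
  · rcases h _ _ hst.symm with ⟨h1, h2⟩ | ⟨h1, h2⟩ <;>
      (have h1 := congrArg Subtype.val h1; have h2 := congrArg Subtype.val h2
       simp at h1 h2)
    · exact absurd (by linarith : (s : ℝ) ≤ 1 / 2) hs
    · exact Or.inr (Or.inr ⟨Subtype.ext (show (s : ℝ) = 1 by linarith), h1⟩)
  · left
    have := congrArg Subtype.val (hq hst)
    ext; simpa using this

theorem Path.nonempty_homeomorph_circle {X : Type*} [TopologicalSpace X] [T2Space X] {a : X}
    (p : Path a a) (hsurj : Function.Surjective p)
    (hinj : ∀ s t, p s = p t → s = t ∨ (s = 0 ∧ t = 1) ∨ (s = 1 ∧ t = 0)) :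
    Nonempty (X ≃ₜ Circle) := by
  have : Fact ((0 : ℝ) < 1) := ⟨one_pos⟩
  let f : AddCircle (1 : ℝ) → X := AddCircle.liftIco 1 0 p.extend
  have hf : Continuous f :=
    AddCircle.liftIco_zero_continuous (by simp) p.continuous_extend.continuousOn
  have hfc : ∀ x ∈ Ico (0 : ℝ) 1, f x = p.extend x := fun x hx =>
    AddCircle.liftIco_zero_coe_apply hx
  have hrep : ∀ z : AddCircle (1 : ℝ), ∃ x ∈ Ico (0 : ℝ) 1, (x : AddCircle (1 : ℝ)) = z := by
    intro z
    have h := (AddCircle.equivIco 1 0 z).2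
    exact ⟨_, ⟨h.1, h.2.trans_eq (zero_add 1)⟩, (AddCircle.equivIco 1 0).symm_apply_apply z⟩
  have hbij : Function.Bijective f := by
    constructor
    · intro z w hzw
      obtain ⟨x, hx, rfl⟩ := hrep z
      obtain ⟨y, hy, rfl⟩ := hrep w
      rw [hfc x hx, hfc y hy, p.extend_apply ⟨hx.1, hx.2.le⟩, p.extend_apply ⟨hy.1, hy.2.le⟩] at hzw
      rcases hinj _ _ hzw with h | ⟨-, h⟩ | ⟨h, -⟩
      · rw [Subtype.mk.inj h]
      · exact absurd (congrArg Subtype.val h) hy.2.ne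
      · exact absurd (congrArg Subtype.val h) hx.2.ne
    · intro x
      obtain ⟨s, rfl⟩ := hsurj x
      rcases s.2.2.eq_or_lt with h | h
      · refine ⟨((0 : ℝ) : AddCircle (1 : ℝ)), ?_⟩
        rw [hfc 0 (by simp)]
        have : s = 1 := Subtype.ext h
        simp [this]
      · exact ⟨((s : ℝ) : AddCircle (1 : ℝ)), by rw [hfc s ⟨s.2.1, h⟩, p.extend_apply s.2]⟩
  let e : AddCircle (1 : ℝ) ≃ₜ X :=
    Continuous.homeoOfEquivCompactToT2 (f := Equiv.ofBijective f hbij) hf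
  exact ⟨e.symm.trans (AddCircle.homeomorphCircle one_ne_zero)⟩

namespace IsArcDecomposition

variable {X ι : Type*} [MetricSpace X] {γ : ι → I → X} {v : X}

/-- Reversing every arc that ends at `v` suffices; injectivity prevents an arc from having `v` at
both ends. -/
theorem exists_oriented (D : IsArcDecomposition γ)
    (hv : ∀ i s, γ i s = v → s = 0 ∨ s = 1) :
    ∃ γ' : ι → I → X, IsArcDecomposition γ' ∧ (∀ i s, γ' i s = v → s = 0) ∧
      ∀ i, range (γ' i) = range (γ i) := by
  classical
  let γ' : ι → I → X := fun i => if γ i 1 = v then γ i ∘ σ else γ i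
  have hor : ∀ i, (γ i 1 = v ∧ γ' i = γ i ∘ σ) ∨ (γ i 1 ≠ v ∧ γ' i = γ i) := by
    intro i
    by_cases h : γ i 1 = v
    · exact Or.inl ⟨h, if_pos h⟩
    · exact Or.inr ⟨h, if_neg h⟩
  have hpt : ∀ i s, ∃ t, γ' i s = γ i t ∧ (t = 0 ∨ t = 1 → s = 0 ∨ s = 1) := by
    intro i s
    rcases hor i with ⟨-, h⟩ | ⟨-, h⟩
    · exact ⟨σ s, by rw [h]; rfl, by simp; tauto⟩
    · exact ⟨s, by rw [h], id⟩
  have hr : ∀ i, range (γ' i) = range (γ i) := by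
    intro i
    rcases hor i with ⟨-, h⟩ | ⟨-, h⟩
    · rw [h, range_comp, symm_bijective.surjective.range_eq, image_univ]
    · rw [h]
  refine ⟨γ', ⟨fun i => ?_, fun i => ?_, fun x => ?_, ?_⟩, fun i s hs => ?_, hr⟩
  · rcases hor i with ⟨-, h⟩ | ⟨-, h⟩
    · rw [h]; exact (D.continuous i).comp continuous_symm
    · rw [h]; exact D.continuous i
  · rcases hor i with ⟨-, h⟩ | ⟨-, h⟩
    · rw [h]; exact (D.injective i).comp symm_bijective.injective
    · rw [h]; exact D.injective i
  · obtain ⟨i, s, rfl⟩ := D.cover x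
    have : γ i s ∈ range (γ' i) := by rw [hr]; exact ⟨s, rfl⟩
    exact ⟨i, this⟩
  · intro i j s t hij hst
    obtain ⟨s', hs, hs'⟩ := hpt i s
    obtain ⟨t', ht, ht'⟩ := hpt j t
    rw [hs, ht] at hst
    exact ⟨hs' (D.inter hij hst).1, ht' (D.inter hij hst).2⟩
  · rcases hor i with ⟨h1, h⟩ | ⟨h1, h⟩
    · rw [h, Function.comp_apply, ← h1] at hs
      have := D.injective i hs
      simpa using this
    · rw [h] at hs
      refine (hv i s hs).resolve_right ?_
      rintro rfl
      exact h1 hs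

theorem eq_zero_or_one_of_mem_range (D : IsArcDecomposition γ) {i j : ι} (hij : i ≠ j)
    (hi : v ∈ range (γ i)) (hj : v ∈ range (γ j)) (k : ι) (s : I) (h : γ k s = v) :
    s = 0 ∨ s = 1 := by
  obtain ⟨a, rfl⟩ := hi
  obtain ⟨b, hb⟩ := hj
  by_cases hk : k = i
  · subst hk
    rw [D.injective _ h]
    exact (D.inter hij hb.symm).1
  · exact (D.inter hk h).1

theorem not_isCompact_nonCutSubcontinua [Finite ι] [CompactSpace X] [ConnectedSpace X]
    (D : IsArcDecomposition γ) {i j k : ι} (hij : i ≠ j) (hik : i ≠ k) (hjk : j ≠ k)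
    (hi : v ∈ range (γ i)) (hj : v ∈ range (γ j)) (hk : v ∈ range (γ k)) :
    ¬ IsCompact (nonCutSubcontinua X) := by
  obtain ⟨γ', D', hv, hr⟩ := D.exists_oriented (D.eq_zero_or_one_of_mem_range hij hi hj)
  have h0 : ∀ i, v ∈ range (γ i) → γ' i 0 = v := by
    intro i hi
    rw [← hr] at hi
    obtain ⟨s, hs⟩ := hi
    rw [← hv i s hs, hs]
  exact D'.not_isCompact_nonCutSubcontinua_of_oriented hv hij hik hjk (h0 i hi) (h0 j hj) (h0 k hk)

theorem exists_ne_mem_range [Finite ι] [PreconnectedSpace X] (D : IsArcDecomposition γ)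
    {S : Set ι} (hS : S.Nonempty) (hS' : Sᶜ.Nonempty) :
    ∃ v, ∃ i ∈ S, ∃ j ∉ S, v ∈ range (γ i) ∧ v ∈ range (γ j) := by
  have hcl : ∀ T : Set ι, IsClosed (⋃ i ∈ T, range (γ i)) := fun T =>
    (toFinite _).isClosed_biUnion fun j _ => by
      rw [← image_univ]
      exact D.isClosed_image j isClosed_univ
  obtain ⟨i, hi⟩ := hS
  obtain ⟨j, hj⟩ := hS'
  obtain ⟨v, -, h1, h2⟩ := isPreconnected_closed_iff.1 (isPreconnected_univ (α := X)) _ _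
    (hcl S) (hcl Sᶜ)
    (by
      intro x _
      obtain ⟨k, hk⟩ := D.cover x
      by_cases h : k ∈ S
      · exact Or.inl (mem_biUnion h hk)
      · exact Or.inr (mem_biUnion (show k ∈ Sᶜ from h) hk))
    ⟨γ i 0, trivial, mem_biUnion hi ⟨0, rfl⟩⟩ ⟨γ j 0, trivial, mem_biUnion hj ⟨0, rfl⟩⟩
  simp only [mem_iUnion, exists_prop] at h1 h2
  obtain ⟨i, hi, hvi⟩ := h1
  obtain ⟨j, hj, hvj⟩ := h2
  exact ⟨v, i, hi, j, hj, hvi, hvj⟩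

theorem merge [DecidableEq ι] (D : IsArcDecomposition γ) {i j : ι} (hij : i ≠ j)
    {μ : I → X} (hμ : Continuous μ) (hinj : Function.Injective μ)
    (hr : range μ = range (γ i) ∪ range (γ j))
    (hend : ∀ k s t, k ≠ i → k ≠ j → γ k s = μ t → t = 0 ∨ t = 1) :
    IsArcDecomposition fun k : {k // k ≠ j} => if (k : ι) = i then μ else γ k := by
  have hμs : ∀ k s t, k ≠ i → k ≠ j → γ k s = μ t → s = 0 ∨ s = 1 := by
    intro k s t hki hkj h
    have : μ t ∈ range (γ i) ∪ range (γ j) := hr ▸ ⟨t, rfl⟩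
    rcases this with ⟨u, hu⟩ | ⟨u, hu⟩
    · exact (D.inter hki (h.trans hu.symm)).1
    · exact (D.inter hkj (h.trans hu.symm)).1
  refine ⟨fun k => ?_, fun k => ?_, fun x => ?_, ?_⟩
  · split_ifs
    exacts [hμ, D.continuous k]
  · split_ifs
    exacts [hinj, D.injective k]
  · obtain ⟨k, s, rfl⟩ := D.cover x
    by_cases hk : k = i ∨ k = j
    · have : γ k s ∈ range μ := by
        rw [hr]
        rcases hk with rfl | rfl
        exacts [Or.inl ⟨s, rfl⟩, Or.inr ⟨s, rfl⟩]
      obtain ⟨t, ht⟩ := this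
      exact ⟨⟨i, hij⟩, t, by simpa using ht⟩
    · push Not at hk
      exact ⟨⟨k, hk.2⟩, s, by simp [hk.1]⟩
  · rintro ⟨k, hk⟩ ⟨l, hl⟩ s t hkl h
    have hkl' : k ≠ l := fun h => hkl (Subtype.ext h)
    dsimp only at h
    split_ifs at h with h1 h2 h2
    · exact absurd (h1.trans h2.symm) hkl'
    · exact ⟨hend l t s h2 hl h.symm, hμs l t s h2 hl h.symm⟩
    · exact ⟨hμs k s t h1 hk h, hend k s t h1 hk h⟩
    · exact D.inter hkl' h

theorem arc_or_circle [Finite ι] [CompactSpace X] [ConnectedSpace X] (D : IsArcDecomposition γ)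
    (hcpt : IsCompact (nonCutSubcontinua X)) :
    Nonempty (X ≃ₜ unitInterval) ∨ Nonempty (X ≃ₜ Circle) := by
  classical
  induction hn : Nat.card ι generalizing ι with
  | zero =>
    obtain ⟨x⟩ := (inferInstance : Nonempty X)
    obtain ⟨i, -⟩ := D.cover x
    exact absurd hn (Nat.card_pos_iff.2 ⟨⟨i⟩, inferInstance⟩).ne'
  | succ n ih =>
    obtain ⟨i₀⟩ : Nonempty ι := (Nat.card_pos_iff.1 (hn ▸ n.succ_pos)).1
    by_cases hsub : ∀ i, i = i₀
    · left
      have hbij : Function.Bijective (γ i₀) := by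
        refine ⟨D.injective i₀, fun x => ?_⟩
        obtain ⟨i, s, h⟩ := D.cover x
        exact ⟨s, hsub i ▸ h⟩
      exact ⟨(Continuous.homeoOfEquivCompactToT2 (f := Equiv.ofBijective _ hbij)
        (D.continuous i₀)).symm⟩
    push Not at hsub
    obtain ⟨i₁, hi₁⟩ := hsub
    obtain ⟨v, i, hi, j, hj, hvi, hvj⟩ := D.exists_ne_mem_range (S := {i₀}) ⟨i₀, rfl⟩ ⟨i₁, hi₁⟩
    have hij : i ≠ j := by
      rintro rfl
      exact hj hi
    obtain ⟨γ', D', hv, hr⟩ := D.exists_oriented (D.eq_zero_or_one_of_mem_range hij hvi hvj)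
    rw [← hr] at hvi hvj
    clear hr D
    have h0 : ∀ i, v ∈ range (γ' i) → γ' i 0 = v := by
      rintro i ⟨s, hs⟩
      rw [← hv i s hs, hs]
    have hi0 := h0 i hvi
    have hj0 := h0 j hvj
    have htriple : ∀ w k, w ∈ range (γ' i) → w ∈ range (γ' j) → k ≠ i → k ≠ j →
        w ∉ range (γ' k) := fun w k hwi hwj hki hkj hwk =>
      D'.not_isCompact_nonCutSubcontinua hij hki.symm hkj.symm hwi hwj hwk hcpt
    let p : Path (γ' i 1) v := Path.symm ⟨⟨γ' i, D'.continuous i⟩, hi0, rfl⟩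
    let q : Path v (γ' j 1) := ⟨⟨γ' j, D'.continuous j⟩, hj0, rfl⟩
    have hp : Function.Injective p := (D'.injective i).comp symm_bijective.injective
    have hq : Function.Injective q := D'.injective j
    have hpa : ∀ s, p s = γ' i (σ s) := fun _ => rfl
    have hqa : ∀ s, q s = γ' j s := fun _ => rfl
    have hpr : range p = range (γ' i) := Path.symm_range _
    have hpq : ∀ s t, p s = q t → (s = 1 ∧ t = 0) ∨ (s = 0 ∧ t = 1) := by
      intro s t h
      rw [hpa, hqa] at h
      obtain ⟨h1, h2⟩ := D'.inter hij h
      rcases h2 with rfl | rfl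
      · rw [hj0] at h
        have := hv _ _ h
        exact Or.inl ⟨by simpa using this, rfl⟩
      · rcases h1 with h1 | h1
        · rw [h1, hi0] at h
          exact absurd (hv _ _ h.symm) one_ne_zero
        · exact Or.inr ⟨by simpa using h1, rfl⟩
    have htr : range (p.trans q) = range (γ' i) ∪ range (γ' j) := by
      rw [Path.trans_range, hpr]; rfl
    -- If the far ends agree too, both ends of either arc are already on two arcs. A third arc would
    -- have to meet the loop at one of them, making a triple point.
    by_cases hw : γ' i 1 = γ' j 1
    · right
      by_cases hk : ∃ k, k ≠ i ∧ k ≠ j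
      · obtain ⟨k, hki, hkj⟩ := hk
        obtain ⟨w, a, ha, b, hb, hwa, hwb⟩ := D'.exists_ne_mem_range (S := {i, j}) ⟨i, by simp⟩
          ⟨k, by simp [hki, hkj]⟩
        simp only [mem_insert_iff, mem_singleton_iff, not_or] at ha hb
        obtain ⟨t, rfl⟩ := hwb
        have hab : a ≠ b := by
          rintro rfl
          rcases ha with h | h
          exacts [hb.1 h, hb.2 h]
        obtain ⟨s, hs⟩ := hwa
        refine absurd ⟨t, rfl⟩ (htriple (γ' b t) b ?_ ?_ hb.1 hb.2)
        all_goals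
          rw [← hs]
          rcases ha with rfl | rfl <;> rcases (D'.inter hab hs).1 with rfl | rfl
        · exact ⟨0, rfl⟩
        · exact ⟨1, rfl⟩
        · exact ⟨0, hi0.trans hj0.symm⟩
        · exact ⟨1, hw⟩
        · exact ⟨0, hj0.trans hi0.symm⟩
        · exact ⟨1, hw.symm⟩
        · exact ⟨0, rfl⟩
        · exact ⟨1, rfl⟩
      · push Not at hk
        refine ((p.trans q).cast rfl hw).nonempty_homeomorph_circle ?_
          fun s t h => Path.trans_apply_eq_trans_apply hp hq hpq h
        intro x
        obtain ⟨k, s, rfl⟩ := D'.cover x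
        change γ' k s ∈ range (p.trans q)
        rw [htr]
        by_cases hki : k = i
        · exact Or.inl (hki ▸ ⟨s, rfl⟩)
        · exact Or.inr (hk k hki ▸ ⟨s, rfl⟩)
    · have hinj : Function.Injective (p.trans q) := by
        intro s t h
        rcases Path.trans_apply_eq_trans_apply hp hq hpq h with h' | ⟨rfl, rfl⟩ | ⟨rfl, rfl⟩
        · exact h'
        · exact absurd (by simpa using h) hw
        · exact absurd (by simpa using h.symm) hw
      -- The only new interior junction of the concatenation is `v`, which no third arc contains.
      have hend : ∀ k s t, k ≠ i → k ≠ j → γ' k s = p.trans q t → t = 0 ∨ t = 1 := by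
        intro k s t hki hkj h
        have hkv : γ' k s ≠ v := fun h' => htriple v k hvi hvj hki hkj ⟨s, h'⟩
        have hm : p.trans q t ∈ range (γ' i) ∪ range (γ' j) := htr ▸ ⟨t, rfl⟩
        rcases hm with ⟨u, hu⟩ | ⟨u, hu⟩
        · rcases (D'.inter hki (h.trans hu.symm)).2 with rfl | rfl
          · exact absurd (h.trans (hu.symm.trans hi0)) hkv
          · exact Or.inl (hinj (hu.symm.trans (p.trans q).source.symm))
        · rcases (D'.inter hkj (h.trans hu.symm)).2 with rfl | rfl
          · exact absurd (h.trans (hu.symm.trans hj0)) hkv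
          · exact Or.inr (hinj (hu.symm.trans (p.trans q).target.symm))
      refine ih (D'.merge hij (p.trans q).continuous hinj htr hend) ?_
      have := Nat.card_congr (Equiv.sumCompl (fun k : ι => k = j))
      rw [Nat.card_sum, hn] at this
      simp only [Nat.card_unique] at this
      change Nat.card {k // ¬ k = j} = n
      omega

end IsArcDecomposition

theorem IsFiniteGraph.exists_isArcDecomposition {X : Type*} [MetricSpace X]
    (hX : IsFiniteGraph X) : ∃ (n : ℕ) (γ : Fin n → I → X), IsArcDecomposition γ := by
  obtain ⟨-, n, γ, hemb, hcov, hint⟩ := hX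
  refine ⟨n, γ, fun i => (hemb i).continuous, fun i => (hemb i).injective, fun x => ?_, ?_⟩
  · have : x ∈ ⋃ i, range (γ i) := hcov ▸ trivial
    simpa using this
  · intro i j s t hij h
    obtain ⟨h1, h2⟩ := hint i j hij ⟨⟨s, rfl⟩, t, h.symm⟩
    refine ⟨h1.imp (fun h => (hemb i).injective h) (fun h => (hemb i).injective h), ?_⟩
    rw [h] at h2
    exact h2.imp (fun h => (hemb j).injective h) (fun h => (hemb j).injective h)

end Classification

theorem mainTheorem3 {X : Type*} [MetricSpace X] (hX : IsFiniteGraph X) :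
    IsCompact (nonCutSubcontinua X) ↔
      Nonempty (X ≃ₜ unitInterval) ∨ Nonempty (X ≃ₜ Circle) := by
  have := hX.1.compact
  have := hX.1.connected
  obtain ⟨n, γ, D⟩ := hX.exists_isArcDecomposition
  refine ⟨D.arc_or_circle, ?_⟩
  rintro (⟨⟨e⟩⟩ | ⟨⟨e⟩⟩)
  · exact isCompact_nonCutSubcontinua_of_arc e
  · exact isCompact_nonCutSubcontinua_of_circle e
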